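/- For an odd integer $p\ge 3$ and integers $g\ge 1$, $0\le c\le \frac{p-3}{2}$, let $D_g^{(2c)}=D_g^{(2c)}(p)=\dim V_p(\Sigma_g,2c)$ be the dimension of the $SO(3)$-TQFT vector space (at a primitive $2p$-th root of unity) of a closed oriented surface of genus $g$ with one point coloured $2c$. Concretely, $V_p(\Sigma_g,2c)$ is the vector space with basis the $p$-admissible even colourings of a connected uni-trivalent graph of first Betti number $g$ with a single leg, coloured $2c$: the edges are coloured by elements of $\{0,2,\dots,p-3\}$, and the three colours $a,b,e$ meeting at each trivalent vertex satisfy the three triangle inequalities, $a+b+e$ is even, and $a+b+e\le 2p-4$. Here the graph is taken to be the chain of $g-1$ bigons followed by one loop: its edges are $s_0,\dots,s_{g-1}$ and $u_i,l_i$ $(0\le i\le g-1)$ with $u_{g-1}=l_{g-1}$, its leg is $s_0$, and its vertices are the triples $(s_i,u_i,l_i)$ for $0\le i\le g-1$ and $(u_i,l_i,s_{i+1})$ for $0\le i\le g-2$. Let $B_k$ be the Bernoulli numbers, $\frac{t}{e^t-1}=\sum_{k\ge0}B_k\frac{t^k}{k!}$ (so $B_1=-\frac12$). **Lemma.** Let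 $g\ge1$ and let $\mathcal E=\{g-1,g+1,g+3,\dots,3g-3\}=\{g-1+2i : 0\le i\le g-1\}$. There are polynomials $\varphi_j\in\mathbb Q[x]$, $j\in\mathcal E\cup\{g\}$, depending only on $g$ and $j$, such that $$D_g^{(2c)}(p)=\sum_{j\in\mathcal E\cup\{g\}}\varphi_j(c)\,p^j$$ for all odd $p\ge3$ and all integers $0\le c\le\frac{p-3}2$. Moreover, for each $j\in\mathcal E\cup\{g\}$ the polynomial $\varphi_j$ has degree exactly $3g-2-j$, and its leading coefficient is $$\frac{(-1)^g}{(j+1-g)!\,(3g-2-j)!}\,B_{j+1-g},\qquad\text{where } B_{j+1-g}\neq0 .$$ -/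

import Mathlib

open scoped Nat

/-- A triple of colours `(a, b, c)` is `p`-admissible (for odd `p`) if `a + b + c` is even, the
three triangle inequalities hold, and `a + b + c ≤ 2p - 4`. -/
def IsPAdmissible (p a b c : ℕ) : Prop :=
  Even (a + b + c) ∧ a ≤ b + c ∧ b ≤ a + c ∧ c ≤ a + b ∧ a + b + c + 4 ≤ 2 * p

/-- The even colours `0, 2, …, p - 3` of the `SO(3)`-theory at odd `p`. The element `i` stands for
the colour `2 i`. -/
abbrev EvenColour (p : ℕ) : Type := Fin ((p - 1) / 2)

/-- The colour named by an element of `EvenColour p`. -/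
def EvenColour.colour {p : ℕ} (i : EvenColour p) : ℕ := 2 * i.1

/-- Admissible even colourings of the following connected uni-trivalent graph with one leg and
first Betti number `g ≥ 1` (a spine of a genus `g` handlebody with one marked boundary point).
It consists of edges `stem 0, …, stem (g-1)` and `upper i, lower i` for `i < g`, where
`upper (g-1)` and `lower (g-1)` are the same edge. The leg is `stem 0`. For each `i < g` there
is a vertex where `stem i`, `upper i`, `lower i` meet, and for each `i` with `i + 1 < g` a vertex
where `upper i`, `lower i`, `stem (i+1)` meet; the edge `upper (g-1) = lower (g-1)` is a loop.

The leg is coloured `2c`, the colours are even, and the triple of colours at each vertex is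
`p`-admissible. -/
structure IsAdmissibleColouring (p g c : ℕ) (stem upper lower : Fin g → EvenColour p) : Prop where
  leg : ∀ i : Fin g, i.1 = 0 → (stem i).colour = 2 * c
  left : ∀ i : Fin g, IsPAdmissible p (stem i).colour (upper i).colour (lower i).colour
  right : ∀ i j : Fin g, j.1 = i.1 + 1 →
    IsPAdmissible p (upper i).colour (lower i).colour (stem j).colour
  loop : ∀ i : Fin g, i.1 + 1 = g → upper i = lower i

/-- The type of admissible even colourings, with the leg coloured `2c`. -/
def AdmissibleColouring (p g c : ℕ) : Type :=
  {x : (Fin g → EvenColour p) × (Fin g → EvenColour p) × (Fin g → EvenColour p) //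
    IsAdmissibleColouring p g c x.1 x.2.1 x.2.2}

/-- The `SO(3)`-TQFT vector space `V_p(Σ_g, 2c)` of a closed surface of genus `g ≥ 1` with one
point coloured `2c`: the complex vector space on the basis of admissible even colourings of a
uni-trivalent spine of the handlebody. -/
abbrev TQFTSpace (p g c : ℕ) : Type := AdmissibleColouring p g c →₀ ℂ

/-- The Verlinde dimension `D_g^{(2c)} = dim V_p(Σ_g, 2c)`. -/
noncomputable def verlindeDim (p g c : ℕ) : ℕ := Module.finrank ℂ (TQFTSpace p g c)

/-- The set of exponents `{g-1, g+1, …, 3g-3} ∪ {g}` (for `g ≥ 1`). -/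
def verlindeExponents (g : ℕ) : Finset ℕ :=
  (Finset.range g).image (fun i => g - 1 + 2 * i) ∪ {g}

/-! Write `p = 2n + 1` and `x = 2c + 1`. Cutting off the first bigon gives a recursion in the genus
whose kernel `(2 min c d + 1)(n - max c d)` counts bigon colourings. This kernel is `p` times the
Green's function of minus the second difference, with boundary conditions `f (-1) = -f 0` and `f n =
0`. One step in the genus thus amounts to solving a difference equation with right-hand side `-p`
times the previous dimension (`sum_green_mul`).

Genus one gives `(p - x) / 2`. By induction the dimension in genus `g + 1` is `A(x) p^(g+1) + ∑
Ψ_k(x) p^(g+2k)` with `A` even and `Ψ_k` odd in `x`. Inverting the second difference raises each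
degree by two and multiplies the leading coefficient by an explicit factor. The condition at `-1`
fixes the constant term of the new `A`. The condition at `n`, that is `x = p`, is met by adding
multiples of `x` to the `Ψ_k`. In the new top term `k = g + 1` this multiple is the leading
coefficient, identified through the vanishing at `1/2` of an odd-index Bernoulli polynomial
(`oddLeadingCoeff_add_sum`). -/

/-! ### Bigon count and recursion in the genus -/

/-- The colourings of the two edges of a bigon whose outer edges are coloured `2c` and `2d`. -/
def BigonColouring (p c d : ℕ) : Type :=
  {x : EvenColour p × EvenColour p //
    IsPAdmissible p (2 * c) x.1.colour x.2.colour ∧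
      IsPAdmissible p x.1.colour x.2.colour (2 * d)}

theorem isPAdmissible_two_mul_iff {p n a b c : ℕ} (hp : p = 2 * n + 1) :
    IsPAdmissible p (2 * a) (2 * b) (2 * c) ↔
      a ≤ b + c ∧ b ≤ a + c ∧ c ≤ a + b ∧ a + b + c + 1 ≤ 2 * n := by
  unfold IsPAdmissible
  rw [Nat.even_iff]
  omega

theorem bigon_iff {p n c d i k : ℕ} (hp : p = 2 * n + 1) :
    (IsPAdmissible p (2 * c) (2 * i) (2 * k) ∧ IsPAdmissible p (2 * i) (2 * k) (2 * d)) ↔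
      i ≤ k + min c d ∧ k ≤ i + min c d ∧ max c d ≤ i + k ∧ i + k + max c d + 1 ≤ 2 * n := by
  rw [isPAdmissible_two_mul_iff hp, isPAdmissible_two_mul_iff hp]
  omega

/-- Bigon colourings are parametrised by the difference and the sum of the two colours. -/
def bigonEquiv {p n c d : ℕ} (hp : p = 2 * n + 1) :
    BigonColouring p c d ≃ Fin (2 * min c d + 1) × Fin (n - max c d) where
  toFun x := by
    refine (⟨x.1.1.1 + min c d - x.1.2.1, ?_⟩, ⟨(x.1.1.1 + x.1.2.1 - max c d) / 2, ?_⟩)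
    all_goals
      have h := (bigon_iff hp).1 x.2
      omega
  invFun y := by
    -- The difference fixes the parity of the sum; the term `% 2` restores it. The sum lies among `2
    -- * (n - max c d)` consecutive integers, half of them of each parity.
    refine ⟨(⟨(max c d + 2 * y.2.1 + (y.1.1 + min c d + max c d) % 2 + y.1.1 - min c d) / 2, ?_⟩,
      ⟨(max c d + 2 * y.2.1 + (y.1.1 + min c d + max c d) % 2 + min c d - y.1.1) / 2, ?_⟩),
      (bigon_iff hp).2 ?_⟩
    all_goals
      have h₁ := y.1.2
      have h₂ := y.2.2
      have h₃ : min c d ≤ max c d := min_le_max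
      try dsimp only
      generalize min c d = m at *
      generalize max c d = M at *
      omega
  left_inv x := by
    have h := (bigon_iff hp).1 x.2
    have h₃ : min c d ≤ max c d := min_le_max
    apply Subtype.ext
    apply Prod.ext <;> apply Fin.ext <;> dsimp only <;>
      generalize min c d = m at * <;> generalize max c d = M at * <;> omega
  right_inv y := by
    have h₁ := y.1.2
    have h₂ := y.2.2
    have h₃ : min c d ≤ max c d := min_le_max
    apply Prod.ext <;> apply Fin.ext <;> dsimp only <;>
      generalize min c d = m at * <;> generalize max c d = M at * <;> omega

theorem card_bigonColouring {p n c d : ℕ} (hp : p = 2 * n + 1) :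
    Nat.card (BigonColouring p c d) = (2 * min c d + 1) * (n - max c d) := by
  rw [Nat.card_congr (bigonEquiv hp)]
  simp

instance (p g c : ℕ) : Finite (AdmissibleColouring p g c) := by
  unfold AdmissibleColouring; infer_instance

instance (p c d : ℕ) : Finite (BigonColouring p c d) := by
  unfold BigonColouring; infer_instance

theorem verlindeDim_eq_card (p g c : ℕ) :
    verlindeDim p g c = Nat.card (AdmissibleColouring p g c) := by
  have := Fintype.ofFinite (AdmissibleColouring p g c)
  rw [verlindeDim, Module.finrank_finsupp_self, Nat.card_eq_fintype_card]

theorem colour_injective {p : ℕ} {i j : EvenColour p} (h : i.colour = j.colour) : i = j := by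
  apply Fin.ext
  unfold EvenColour.colour at h
  omega

/-- In genus one, a colouring is a bigon colouring with trivial outer colour. -/
def genusOneEquiv {p n c : ℕ} (hp : p = 2 * n + 1) (hc : c < n) :
    AdmissibleColouring p 1 c ≃ BigonColouring p c 0 where
  toFun x := ⟨(x.1.2.1 0, x.1.2.2 0), by
    have h₁ := x.2.leg 0 rfl
    have h₂ := x.2.left 0
    have h₃ := x.2.loop 0 rfl
    rw [h₁, ← h₃] at h₂
    change IsPAdmissible p (2 * c) (x.1.2.1 0).colour (x.1.2.2 0).colour ∧
      IsPAdmissible p (x.1.2.1 0).colour (x.1.2.2 0).colour (2 * 0)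
    rw [← h₃]
    refine ⟨h₂, ?_⟩
    unfold EvenColour.colour at *
    rw [isPAdmissible_two_mul_iff hp] at h₂
    rw [isPAdmissible_two_mul_iff hp]
    omega⟩
  invFun y := ⟨(fun _ => ⟨c, by omega⟩, fun _ => y.1.1, fun _ => y.1.2), by
    have h := (bigon_iff hp).1 y.2
    refine ⟨fun _ _ => rfl, fun _ => y.2.1, fun i j hij => ?_, fun _ _ => ?_⟩
    · omega
    -- The outer colour `0` makes the minimum zero, which forces the two bigon edges to agree.
    · apply Fin.ext
      simp only [Nat.min_zero] at h
      dsimp only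
      omega⟩
  left_inv x := by
    apply Subtype.ext
    refine Prod.ext ?_ (Prod.ext ?_ ?_) <;> funext i <;> obtain rfl := Subsingleton.elim i 0
    · apply colour_injective
      rw [x.2.leg 0 rfl]
      rfl
    · rfl
    · rfl
  right_inv y := rfl

theorem sigma_colouring_ext {p n g c : ℕ}
    {y z : Σ d : Fin n, BigonColouring p c d × AdmissibleColouring p g d}
    (h₁ : y.1 = z.1) (h₂ : y.2.1.1 = z.2.1.1) (h₃ : y.2.2.1 = z.2.2.1) : y = z := by
  obtain ⟨d, b, x⟩ := y
  obtain ⟨e, b', x'⟩ := z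
  obtain rfl : d = e := h₁
  obtain rfl : b = b' := Subtype.ext h₂
  obtain rfl : x = x' := Subtype.ext h₃
  rfl

/-- Cutting off the first bigon. -/
def succGenusEquiv {p n g c : ℕ} (hp : p = 2 * n + 1) (hc : c < n) :
    AdmissibleColouring p (g + 2) c ≃
      Σ d : Fin n, BigonColouring p c d × AdmissibleColouring p (g + 1) d where
  toFun x := ⟨⟨(x.1.1 1).1, by have := (x.1.1 1).2; omega⟩,
    ⟨(x.1.2.1 0, x.1.2.2 0), by
      have h := x.2.left 0
      rw [x.2.leg 0 rfl] at h
      exact ⟨h, x.2.right 0 1 rfl⟩⟩,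
    ⟨(Fin.tail x.1.1, Fin.tail x.1.2.1, Fin.tail x.1.2.2), by
      refine ⟨fun i hi => ?_, fun i => x.2.left _, fun i j hij => x.2.right _ _ (by simpa using hij),
        fun i hi => x.2.loop _ (by simpa using hi)⟩
      obtain rfl : i = 0 := Fin.ext hi
      rfl⟩⟩
  invFun y := ⟨(Fin.cons ⟨c, by omega⟩ y.2.2.1.1, Fin.cons y.2.1.1.1 y.2.2.1.2.1,
      Fin.cons y.2.1.1.2 y.2.2.1.2.2), by
    obtain ⟨d, b, z⟩ := y
    dsimp only
    refine ⟨fun i hi => ?_, fun i => ?_, fun i j hij => ?_, fun i hi => ?_⟩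
    · obtain rfl : i = 0 := Fin.ext hi
      rfl
    · refine Fin.cases ?_ (fun i => ?_) i
      · exact b.2.1
      · simpa using z.2.left i
    · revert hij
      refine Fin.cases ?_ (fun i => ?_) i <;> refine Fin.cases ?_ (fun j => ?_) j
      · intro h
        simp at h
      · intro h
        have hj : j = 0 := by
          apply Fin.ext
          simpa using h
        subst hj
        simp only [Fin.cons_zero, Fin.cons_succ]
        rw [z.2.leg 0 rfl]
        exact b.2.2
      · intro h
        simp at h
      · intro h
        simpa using z.2.right i j (by simpa using h)
    · revert hi
      refine Fin.cases ?_ (fun i => ?_) i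
      · intro h
        simp at h
      · intro h
        simpa using z.2.loop i (by simpa using h)⟩
  left_inv x := by
    apply Subtype.ext
    refine Prod.ext ?_ (Prod.ext ?_ ?_) <;> dsimp only
    · funext i
      refine Fin.cases ?_ (fun i => ?_) i
      · apply colour_injective
        rw [x.2.leg 0 rfl]
        rfl
      · rfl
    · exact Fin.cons_self_tail _
    · exact Fin.cons_self_tail _
  right_inv y := by
    obtain ⟨d, b, z⟩ := y
    have hd : (z.1.1 0).1 = d := by
      have := z.2.leg 0 rfl
      unfold EvenColour.colour at this
      omega
    exact sigma_colouring_ext (Fin.ext hd) rfl rfl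

theorem verlindeDim_one {p n c : ℕ} (hp : p = 2 * n + 1) (hc : c < n) :
    verlindeDim p 1 c = n - c := by
  rw [verlindeDim_eq_card, Nat.card_congr (genusOneEquiv hp hc), card_bigonColouring hp]
  simp

theorem verlindeDim_succ {p n g c : ℕ} (hp : p = 2 * n + 1) (hc : c < n) :
    verlindeDim p (g + 2) c =
      ∑ d ∈ Finset.range n, (2 * min c d + 1) * (n - max c d) * verlindeDim p (g + 1) d := by
  rw [verlindeDim_eq_card, Nat.card_congr (succGenusEquiv hp hc), Nat.card_sigma,
    ← Fin.sum_univ_eq_sum_range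
      (fun d => (2 * min c d + 1) * (n - max c d) * verlindeDim p (g + 1) d)]
  refine Finset.sum_congr rfl fun d _ => ?_
  rw [Nat.card_prod, card_bigonColouring hp, verlindeDim_eq_card]

/-! ### The bigon kernel as a Green's function -/

/-- Summation against the Green's function of the second difference operator. -/
theorem sum_green_mul {n c : ℕ} (hc : c ≤ n) (f : ℤ → ℚ) (h : ℕ → ℚ)
    (hneg : f (-1) = -f 0) (hn : f n = 0)
    (hf : ∀ d : ℕ, d < n → f (d + 1) - 2 * f d + f (d - 1) = -(2 * n + 1) * h d) :
    ∑ d ∈ Finset.range n, ((2 * min c d + 1) * (n - max c d) : ℕ) * h d = f c := by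
  -- Summation by parts: `2d + 1` is killed by the second difference and satisfies the boundary
  -- condition at `-1`, so the sum telescopes.
  have left : ∀ k ≤ n, ∑ d ∈ Finset.range k, (2 * d + 1 : ℚ) * ((2 * n + 1) * h d) =
      (2 * k + 1) * f (k - 1) - (2 * k - 1) * f k := by
    intro k
    induction k with
    | zero => simp [hneg]
    | succ k ih =>
      intro hk
      rw [Finset.sum_range_succ, ih (by omega)]
      push_cast
      rw [add_sub_cancel_right]
      linear_combination (2 * k + 1 : ℚ) * hf k (by omega)
  -- The same with `n - d`, the affine function vanishing at the other end.
  have right : ∀ k, c + k ≤ n →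
      ∑ d ∈ Finset.range k, (n - (c + d : ℕ) : ℚ) * ((2 * n + 1) * h (c + d)) =
        (n - (c + k : ℕ)) * f ((c + k : ℕ) - 1) - (n - (c + k : ℕ) + 1) * f (c + k : ℕ)
          - ((n - c) * f (c - 1) - (n - c + 1) * f c) := by
    intro k
    induction k with
    | zero => simp
    | succ k ih =>
      intro hk
      rw [Finset.sum_range_succ, ih (by omega)]
      have := hf (c + k) (by omega)
      push_cast at this ⊢
      have e : (c + (k + 1) - 1 : ℤ) = c + k := by ring
      rw [e, ← add_assoc (c : ℤ)]
      linear_combination (n - (c + k) : ℚ) * this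
  have hp : (2 * n + 1 : ℚ) ≠ 0 := by positivity
  apply mul_left_cancel₀ hp
  obtain ⟨m, rfl⟩ := Nat.exists_eq_add_of_le hc
  rw [Finset.sum_range_add, mul_add, Finset.mul_sum, Finset.mul_sum]
  have e₁ : ∑ d ∈ Finset.range c, (2 * ((c + m : ℕ) : ℚ) + 1) *
      (((2 * min c d + 1) * (c + m - max c d) : ℕ) * h d) =
      m * ∑ d ∈ Finset.range c, (2 * d + 1 : ℚ) * ((2 * (c + m : ℕ) + 1) * h d) := by
    rw [Finset.mul_sum]
    refine Finset.sum_congr rfl fun d hd => ?_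
    have := Finset.mem_range.1 hd
    rw [min_eq_right this.le, max_eq_left this.le, Nat.add_sub_cancel_left]
    push_cast
    ring
  have e₂ : ∑ d ∈ Finset.range m, (2 * ((c + m : ℕ) : ℚ) + 1) *
      (((2 * min c (c + d) + 1) * (c + m - max c (c + d)) : ℕ) * h (c + d)) =
      (2 * c + 1) * ∑ d ∈ Finset.range m, ((c + m : ℕ) - (c + d : ℕ) : ℚ) *
        ((2 * (c + m : ℕ) + 1) * h (c + d)) := by
    rw [Finset.mul_sum]
    refine Finset.sum_congr rfl fun d hd => ?_
    have := Finset.mem_range.1 hd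
    rw [min_eq_left (by omega), max_eq_right (by omega)]
    push_cast [Nat.cast_sub (show c + d ≤ c + m by omega)]
    ring
  rw [e₁, e₂, left c hc, right m le_rfl, hn]
  push_cast
  ring

/-! ### Second differences of polynomials, with parity -/

section

open Polynomial

theorem sum_range_two_mul (u : ℕ → ℚ) (N : ℕ) : ∑ i ∈ Finset.range (2 * N), u i =
    ∑ j ∈ Finset.range N, u (2 * j) + ∑ j ∈ Finset.range N, u (2 * j + 1) := by
  induction N with
  | zero => simp
  | succ N ih =>
    rw [mul_add, Finset.sum_range_succ, Finset.sum_range_succ, ih, Finset.sum_range_succ,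
      Finset.sum_range_succ]
    ring

/-- The second difference operator with step `2`. -/
noncomputable def secondDiff : ℚ[X] →ₗ[ℚ] ℚ[X] :=
  taylor 2 - (2 : ℚ) • LinearMap.id + taylor (-2)

theorem eval_secondDiff (f : ℚ[X]) (x : ℚ) :
    (secondDiff f).eval x = f.eval (x + 2) - 2 * f.eval x + f.eval (x - 2) := by
  simp [secondDiff, taylor_eval, add_comm, sub_eq_add_neg]

theorem coeff_secondDiff_X_pow (n k : ℕ) :
    (secondDiff (X ^ n)).coeff k =
      (2 ^ (n - k) + (-2) ^ (n - k)) * n.choose k - if k = n then 2 else 0 := by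
  simp only [secondDiff, LinearMap.add_apply, LinearMap.sub_apply, LinearMap.smul_apply,
    LinearMap.id_apply, taylor_X_pow, coeff_add, coeff_sub, coeff_X_add_C_pow, coeff_smul,
    coeff_X_pow, smul_eq_mul, mul_ite, mul_one, mul_zero]
  ring

theorem coeff_secondDiff_X_pow_self (n : ℕ) :
    (secondDiff (X ^ (n + 2))).coeff n = 4 * (n + 2) * (n + 1) := by
  have h : (n + 2).choose n * 2 = (n + 2) * (n + 1) := by
    rw [Nat.choose_symm_add, Nat.choose_two_right]
    exact Nat.div_mul_cancel (Nat.even_mul_pred_self (n + 2)).two_dvd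
  rw [coeff_secondDiff_X_pow, if_neg (by omega), Nat.add_sub_cancel_left]
  have h' : ((n + 2).choose n * 2 : ℚ) = (n + 2) * (n + 1) := mod_cast h
  linear_combination 4 * h'

/-- The shifts by `2` and `-2` cancel in odd codegree, and the middle term `-2 f` removes codegree
zero. -/
theorem natDegree_secondDiff_X_pow_le (n : ℕ) : (secondDiff (X ^ (n + 2))).natDegree ≤ n := by
  rw [natDegree_le_iff_coeff_eq_zero]
  intro k hk
  rw [coeff_secondDiff_X_pow]
  obtain rfl | rfl | h : k = n + 1 ∨ k = n + 2 ∨ n + 2 < k := by omega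
  · rw [if_neg (by omega), show n + 2 - (n + 1) = 1 by omega]
    ring
  · norm_num
  · rw [Nat.choose_eq_zero_of_lt h, if_neg (by omega)]
    simp

/-- The leading term is matched by a monomial two degrees higher, and the remainder is handled by
induction. The top coefficient is kept because the leading coefficients of the expansion are
computed from it. -/
theorem exists_secondDiff_eq (n : ℕ) : ∀ f : ℚ[X], f.natDegree ≤ n →
    ∃ F : ℚ[X], secondDiff F = f ∧ F.natDegree ≤ n + 2 ∧
      F.coeff (n + 2) = f.coeff n / (4 * (n + 2) * (n + 1)) := by
  induction n with
  | zero =>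
    intro f hf
    refine ⟨(f.coeff 0 / 8) • X ^ 2, ?_, ?_, ?_⟩
    · have h₁ := natDegree_secondDiff_X_pow_le 0
      have h₂ := coeff_secondDiff_X_pow_self 0
      rw [map_smul, eq_C_of_natDegree_le_zero h₁, h₂, smul_C]
      conv_rhs => rw [eq_C_of_natDegree_le_zero hf]
      congr 1
      simp only [smul_eq_mul]
      push_cast
      ring
    · exact (natDegree_smul_le _ _).trans (natDegree_X_pow_le 2)
    · norm_num [coeff_X_pow]
  | succ n ih =>
    intro f hf
    have hn : (4 * ((n + 1 : ℕ) + 2) * ((n + 1 : ℕ) + 1) : ℚ) ≠ 0 := by positivity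
    set b := f.coeff (n + 1) / (4 * ((n + 1 : ℕ) + 2) * ((n + 1 : ℕ) + 1)) with hb
    obtain ⟨F, hF, hd, -⟩ := ih (f - b • secondDiff (X ^ (n + 1 + 2))) (by
      rw [natDegree_le_iff_coeff_eq_zero]
      intro k hk
      rw [coeff_sub, coeff_smul]
      obtain rfl | h : k = n + 1 ∨ n + 1 < k := by omega
      · rw [coeff_secondDiff_X_pow_self, hb, smul_eq_mul, div_mul_cancel₀ _ hn, sub_self]
      · rw [coeff_eq_zero_of_natDegree_lt (hf.trans_lt h), coeff_eq_zero_of_natDegree_lt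
          ((natDegree_secondDiff_X_pow_le _).trans_lt h)]
        simp)
    refine ⟨F + b • X ^ (n + 1 + 2), ?_, ?_, ?_⟩
    · rw [map_add, hF, map_smul, sub_add_cancel]
    · exact natDegree_add_le_of_degree_le (by omega)
        ((natDegree_smul_le _ _).trans (natDegree_X_pow_le _))
    · rw [coeff_add, coeff_eq_zero_of_natDegree_lt (by omega : F.natDegree < n + 1 + 2)]
      simp

theorem secondDiff_comp_neg_X (f : ℚ[X]) :
    secondDiff (f.comp (-X)) = (secondDiff f).comp (-X) := by
  apply Polynomial.funext
  intro x
  simp only [eval_comp, eval_secondDiff, eval_neg, eval_X]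
  ring_nf

theorem coeff_comp_neg_X (f : ℚ[X]) (i : ℕ) :
    (f.comp (-X)).coeff i = (-1) ^ i * f.coeff i := by
  rw [show (-X : ℚ[X]) = C (-1) * X by simp, comp_C_mul_X_coeff, mul_comm]

/-- The polynomial `f` has the parity of `n`, degree at most `n`, and coefficient `a` in
degree `n`. -/
structure HasParityTerm (n : ℕ) (a : ℚ) (f : ℚ[X]) : Prop where
  natDegree_le : f.natDegree ≤ n
  coeff_eq : f.coeff n = a
  comp_neg : f.comp (-X) = (-1 : ℚ) ^ n • f

namespace HasParityTerm

variable {n : ℕ} {a b : ℚ} {f h : ℚ[X]}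

theorem add (hf : HasParityTerm n a f) (hh : HasParityTerm n b h) :
    HasParityTerm n (a + b) (f + h) where
  natDegree_le := natDegree_add_le_of_degree_le hf.1 hh.1
  coeff_eq := by rw [coeff_add, hf.2, hh.2]
  comp_neg := by rw [add_comp, hf.3, hh.3, smul_add]

theorem smul (r : ℚ) (hf : HasParityTerm n a f) : HasParityTerm n (r * a) (r • f) where
  natDegree_le := (natDegree_smul_le _ _).trans hf.1
  coeff_eq := by rw [coeff_smul, hf.2, smul_eq_mul]
  comp_neg := by rw [smul_comp, hf.3, smul_comm]

theorem zero (n : ℕ) : HasParityTerm n 0 0 where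
  natDegree_le := by simp
  coeff_eq := by simp
  comp_neg := by simp

theorem sum {ι : Type*} (s : Finset ι) {u : ι → ℚ} {v : ι → ℚ[X]}
    (h : ∀ i ∈ s, HasParityTerm n (u i) (v i)) :
    HasParityTerm n (∑ i ∈ s, u i) (∑ i ∈ s, v i) := by
  classical
  induction s using Finset.induction_on with
  | empty => simpa using zero n
  | insert i s hi ih =>
    rw [Finset.sum_insert hi, Finset.sum_insert hi]
    exact (h i (Finset.mem_insert_self _ _)).add
      (ih fun j hj => h j (Finset.mem_insert_of_mem hj))

theorem X_pow (n : ℕ) : HasParityTerm n 1 (X ^ n) where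
  natDegree_le := natDegree_X_pow_le n
  coeff_eq := by simp
  comp_neg := by rw [X_pow_comp, neg_pow, smul_eq_C_mul]; simp

theorem mul_X_pow (hf : HasParityTerm n a f) (m : ℕ) : HasParityTerm (n + m) a (f * X ^ m) where
  natDegree_le := natDegree_mul_le_of_le hf.1 (natDegree_X_pow_le m)
  coeff_eq := by rw [coeff_mul_X_pow, hf.2]
  comp_neg := by rw [mul_comp, hf.3, (X_pow m).3, smul_mul_smul_comm, pow_add]

theorem raise (hf : HasParityTerm n a f) (m : ℕ) (hm : m ≠ 0) :
    HasParityTerm (n + 2 * m) 0 f where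
  natDegree_le := hf.1.trans (by omega)
  coeff_eq := coeff_eq_zero_of_natDegree_lt (hf.1.trans_lt (by omega))
  comp_neg := by rw [hf.3, pow_add, pow_mul]; simp

theorem eval_neg (hf : HasParityTerm n a f) (x : ℚ) : f.eval (-x) = (-1) ^ n * f.eval x := by
  have := congrArg (eval x) hf.3
  simpa [eval_comp] using this

theorem coeff_eq_zero (hf : HasParityTerm n a f) {i : ℕ} (hi : ¬ (Even i ↔ Even n)) :
    f.coeff i = 0 := by
  have := congrArg (fun q => coeff q i) hf.3
  simp only [coeff_comp_neg_X, coeff_smul, smul_eq_mul] at this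
  rcases Nat.even_or_odd i with h₁ | h₁ <;> rcases Nat.even_or_odd n with h₂ | h₂
  · exact absurd (iff_of_true h₁ h₂) hi
  · rw [h₁.neg_one_pow, h₂.neg_one_pow] at this
    linarith
  · rw [h₁.neg_one_pow, h₂.neg_one_pow] at this
    linarith
  · exact absurd (iff_of_false (Nat.not_even_iff_odd.2 h₁) (Nat.not_even_iff_odd.2 h₂)) hi

theorem eval_eq_sum_odd {m : ℕ} (hf : HasParityTerm (2 * m + 1) a f) (x : ℚ) :
    f.eval x = ∑ j ∈ Finset.range (m + 1), f.coeff (2 * j + 1) * x ^ (2 * j + 1) := by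
  rw [eval_eq_sum_range' (n := 2 * (m + 1)) (by have := hf.1; omega), sum_range_two_mul,
    ← Finset.sum_add_distrib]
  refine Finset.sum_congr rfl fun j _ => ?_
  rw [hf.coeff_eq_zero (i := 2 * j) (by simp [parity_simps]), zero_mul, zero_add]

/-- The second difference commutes with `x ↦ -x`, so a solution may be averaged with its signed
reflection. -/
theorem exists_secondDiff (hf : HasParityTerm n a f) :
    ∃ F : ℚ[X], secondDiff F = f ∧ HasParityTerm (n + 2) (a / (4 * (n + 2) * (n + 1))) F := by
  obtain ⟨F, hF, hd, hc⟩ := exists_secondDiff_eq n f hf.1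
  have hsq : ((-1 : ℚ) ^ n) * (-1) ^ n = 1 := by rw [← mul_pow]; simp
  refine ⟨(1 / 2 : ℚ) • (F + (-1 : ℚ) ^ n • F.comp (-X)), ?_, ?_, ?_, ?_⟩
  · rw [map_smul, map_add, map_smul, secondDiff_comp_neg_X, hF, hf.3, smul_smul, hsq, one_smul,
      ← two_smul ℚ f, smul_smul]
    norm_num
  · refine (natDegree_smul_le _ _).trans (natDegree_add_le_of_degree_le hd ?_)
    refine (natDegree_smul_le _ _).trans ?_
    rw [natDegree_comp, natDegree_neg, natDegree_X, mul_one]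
    exact hd
  · rw [coeff_smul, coeff_add, coeff_smul, coeff_comp_neg_X, hc, hf.2, smul_eq_mul, smul_eq_mul,
      ← mul_assoc, pow_add, ← mul_assoc, hsq]
    ring
  · rw [smul_comp, add_comp, smul_comp, comp_assoc, neg_comp, X_comp, neg_neg, comp_X,
      smul_comm _ (1 / 2 : ℚ), pow_add, neg_one_sq, mul_one]
    congr 1
    rw [smul_add, smul_smul, hsq, one_smul, add_comm]

end HasParityTerm

/-! ### Bernoulli numbers and leading coefficients -/

/-- For `k > 0`, Euler's formula makes the zeta value at `2k` a multiple of this number; a vanishing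
sum of nonnegative terms would force the term at `1` to vanish. -/
theorem bernoulli_two_mul_ne_zero (k : ℕ) : _root_.bernoulli (2 * k) ≠ 0 := by
  rcases eq_or_ne k 0 with rfl | hk
  · simp
  · intro h
    have hs := hasSum_zeta_nat hk
    rw [h, Rat.cast_zero, mul_zero, zero_div,
      hasSum_zero_iff_of_nonneg (fun n => by positivity)] at hs
    simpa using congrFun hs 1

/-- The leading coefficient, as a polynomial in `2c + 1`, of the coefficient of `p ^ (g + 2k)`
in the Verlinde dimension in genus `g + 1`. -/
def evenLeadingCoeff (g k : ℕ) : ℚ :=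
  (-1) ^ (g + 1) * _root_.bernoulli (2 * k) /
    ((2 * k)! * (2 * (g - k) + 1)! * 2 ^ (2 * (g - k) + 1))

/-- The leading coefficient, as a polynomial in `2c + 1`, of the coefficient of `p ^ (g + 1)`
in the Verlinde dimension in genus `g + 1`. -/
def oddLeadingCoeff (g : ℕ) : ℚ := (-1) ^ g / (2 * (2 * g)! * 2 ^ (2 * g))

/-- This is the vanishing at `1/2` of the Bernoulli polynomial of index `2g + 1`, a consequence of
its antisymmetry under `x ↦ 1 - x`. The only odd-index Bernoulli number contributing is `B₁`, which
yields `oddLeadingCoeff`. -/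
theorem oddLeadingCoeff_add_sum {g : ℕ} (hg : g ≠ 0) :
    oddLeadingCoeff g + ∑ k ∈ Finset.range (g + 1), evenLeadingCoeff g k = 0 := by
  have h : (Polynomial.bernoulli (2 * g + 1)).eval (1 / 2) = 0 := by
    have := Polynomial.bernoulli_eval_one_sub (2 * g + 1) (1 / 2)
    rw [Odd.neg_one_pow (odd_two_mul_add_one g), show (1 - 1 / 2 : ℚ) = 1 / 2 by norm_num] at this
    linarith
  rw [Polynomial.bernoulli, eval_finsetSum, show 2 * g + 1 + 1 = 2 * (g + 1) by ring,
    sum_range_two_mul] at h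
  simp only [eval_monomial] at h
  rw [Finset.sum_eq_single (a := 0) (s := Finset.range (g + 1))
    (f := fun j => _root_.bernoulli (2 * j + 1) * _ * _) (fun j _ hj => by
      rw [bernoulli_eq_zero_of_odd (odd_two_mul_add_one j) (by omega)]; simp)
    (fun h => absurd (Finset.mem_range.2 (Nat.succ_pos g)) h)] at h
  have e : ∀ k ∈ Finset.range (g + 1), _root_.bernoulli (2 * k) * ((2 * g + 1).choose (2 * k) : ℚ) *
      (1 / 2) ^ (2 * g + 1 - 2 * k) = (-1) ^ (g + 1) * (2 * g + 1)! * evenLeadingCoeff g k := by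
    intro k hk
    have hk := Finset.mem_range.1 hk
    have hsq : ((-1 : ℚ) ^ (g + 1)) * (-1) ^ (g + 1) = 1 := by rw [← mul_pow]; simp
    rw [Nat.cast_choose ℚ (by omega : 2 * k ≤ 2 * g + 1), evenLeadingCoeff,
      show 2 * g + 1 - 2 * k = 2 * (g - k) + 1 by omega, one_div, inv_pow]
    have h₁ : ((2 * k)! : ℚ) ≠ 0 := by positivity
    have h₂ : ((2 * (g - k) + 1)! : ℚ) ≠ 0 := by positivity
    field_simp
    linear_combination (-_root_.bernoulli (2 * k)) * hsq
  rw [Finset.sum_congr rfl e, ← Finset.mul_sum] at h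
  have hsq : ((-1 : ℚ) ^ g) * (-1) ^ g = 1 := by rw [← mul_pow]; simp
  have hf : ((2 * g + 1)! : ℚ) = (2 * g + 1) * (2 * g)! := by
    rw [Nat.factorial_succ]; push_cast; ring
  have hne : ((-1) ^ (g + 1) * (2 * g + 1)! : ℚ) ≠ 0 := by
    apply mul_ne_zero
    · exact pow_ne_zero _ (by norm_num)
    · positivity
  apply mul_left_cancel₀ hne
  rw [mul_add, mul_zero, ← h, add_comm, add_right_inj, oddLeadingCoeff, hf]
  simp only [mul_zero, zero_add, _root_.bernoulli_one, Nat.choose_one_right, Nat.add_sub_cancel]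
  rw [one_div, inv_pow]
  have h₁ : ((2 * g)! : ℚ) ≠ 0 := by positivity
  push_cast
  field_simp
  rw [pow_succ]
  linear_combination (-1 : ℚ) * hsq

/-- The factor is the effect on a leading coefficient of solving `secondDiff Φ = -Ψ` in degree `2 *
(g - k) + 1`. -/
theorem evenLeadingCoeff_succ {g k : ℕ} (hk : k ≤ g) :
    evenLeadingCoeff (g + 1) k =
      -evenLeadingCoeff g k / (4 * ((2 * (g - k) + 1 : ℕ) + 2) * ((2 * (g - k) + 1 : ℕ) + 1)) := by
  obtain ⟨m, rfl⟩ := Nat.exists_eq_add_of_le hk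
  unfold evenLeadingCoeff
  rw [show k + m + 1 - k = m + 1 by omega, Nat.add_sub_cancel_left,
    show 2 * (m + 1) + 1 = 2 * m + 1 + 1 + 1 by ring, Nat.factorial_succ (2 * m + 1 + 1),
    Nat.factorial_succ (2 * m + 1)]
  push_cast
  field_simp
  ring

theorem oddLeadingCoeff_succ (g : ℕ) :
    oddLeadingCoeff (g + 1) =
      -oddLeadingCoeff g / (4 * ((2 * g : ℕ) + 2) * ((2 * g : ℕ) + 1)) := by
  unfold oddLeadingCoeff
  rw [show 2 * (g + 1) = 2 * g + 1 + 1 by ring, Nat.factorial_succ (2 * g + 1),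
    Nat.factorial_succ (2 * g)]
  push_cast
  field_simp
  ring

/-! ### The expansion in powers of p, by induction on the genus -/

theorem secondDiff_X : secondDiff X = 0 := by
  apply Polynomial.funext
  intro x
  rw [eval_secondDiff]
  simp
  ring

theorem secondDiff_C (r : ℚ) : secondDiff (C r) = 0 := by
  apply Polynomial.funext
  intro x
  rw [eval_secondDiff]
  simp
  ring

/-- The expansion of the Verlinde dimension in genus `g + 1` in powers of `p`, the coefficients
being even or odd polynomials in `2c + 1`. -/
structure VerlindeExpansion (g : ℕ) (A : ℚ[X]) (Ψ : ℕ → ℚ[X]) : Prop where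
  odd_coeff : HasParityTerm (2 * g) (oddLeadingCoeff g) A
  even_coeff : ∀ k ≤ g, HasParityTerm (2 * (g - k) + 1) (evenLeadingCoeff g k) (Ψ k)
  verlindeDim_eq : ∀ n c : ℕ, c < n → (verlindeDim (2 * n + 1) (g + 1) c : ℚ) =
    A.eval (2 * c + 1 : ℚ) * (2 * n + 1) ^ (g + 1) +
      ∑ k ∈ Finset.range (g + 1), (Ψ k).eval (2 * c + 1 : ℚ) * (2 * n + 1) ^ (g + 2 * k)

theorem verlindeExpansion_zero :
    VerlindeExpansion 0 ((1 / 2 : ℚ) • X ^ 0) (fun _ => (-1 / 2 : ℚ) • X ^ 1) where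
  odd_coeff := by
    convert (HasParityTerm.X_pow 0).smul (1 / 2) using 1
    norm_num [oddLeadingCoeff]
  even_coeff k hk := by
    obtain rfl : k = 0 := by omega
    convert (HasParityTerm.X_pow 1).smul (-1 / 2) using 1
    norm_num [evenLeadingCoeff]
  verlindeDim_eq n c hc := by
    rw [verlindeDim_one rfl hc, Nat.cast_sub hc.le]
    simp
    ring

theorem VerlindeExpansion.succ {g : ℕ} {A : ℚ[X]} {Ψ : ℕ → ℚ[X]} (h : VerlindeExpansion g A Ψ) :
    ∃ A' Ψ', VerlindeExpansion (g + 1) A' Ψ' := by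
  obtain ⟨B, hB, hB'⟩ := (h.odd_coeff.smul (-1)).exists_secondDiff
  -- The new index `k = g + 1` has no source term; there `Φ` is zero and only the later linear
  -- correction contributes.
  have hΦ : ∀ k, ∃ Φ : ℚ[X], secondDiff Φ = (if k ≤ g then -Ψ k else 0) ∧
      HasParityTerm (2 * (g + 1 - k) + 1) (if k ≤ g then evenLeadingCoeff (g + 1) k else 0) Φ := by
    intro k
    by_cases hk : k ≤ g
    · obtain ⟨Φ, h₁, h₂⟩ := ((h.even_coeff k hk).smul (-1)).exists_secondDiff
      refine ⟨Φ, ?_, ?_⟩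
      · rw [h₁, if_pos hk, neg_one_smul]
      · rw [if_pos hk, evenLeadingCoeff_succ hk, ← neg_one_mul,
          show 2 * (g + 1 - k) + 1 = 2 * (g - k) + 1 + 2 by omega]
        exact h₂
    · simp only [if_neg hk]
      exact ⟨0, map_zero _, HasParityTerm.zero _⟩
  choose Φ hΦ hΦ' using hΦ
  -- The condition `f (-1) = -f 0` compares `x = -1` with `x = 1`. Since `A'` is even, it is enough
  -- that `A'` vanish at `1`.
  set A' : ℚ[X] := B + (-B.eval 1) • X ^ 0 with hA'
  have hA₀ : HasParityTerm (2 * (g + 1)) (oddLeadingCoeff (g + 1)) A' := by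
    have h₁ := ((HasParityTerm.X_pow 0).smul (-B.eval 1)).raise (g + 1) (by omega)
    have h₂ : HasParityTerm (2 * (g + 1)) (oddLeadingCoeff (g + 1)) B := by
      rw [oddLeadingCoeff_succ, ← neg_one_mul]
      exact hB'
    rw [zero_add] at h₁
    convert h₂.add h₁ using 1
    rw [add_zero]
  have hA₁ : A'.eval 1 = 0 := by simp [hA']
  have hA₂ : secondDiff A' = -A := by
    rw [hA', pow_zero, map_add, hB, smul_eq_C_mul (-B.eval 1), mul_one, secondDiff_C, add_zero,
      neg_one_smul]
  -- At `x = p`, the candidate solution before linear correction equals `p ^ (g + 1)` times the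
  -- value of `T` at `p`. By parity `T` is an odd polynomial.
  set T : ℚ[X] := A' * X ^ 1 + ∑ k ∈ Finset.range (g + 2), Φ k * X ^ (2 * k) with hT
  have hT₀ : HasParityTerm (2 * (g + 1) + 1) (-evenLeadingCoeff (g + 1) (g + 1)) T := by
    have h₁ := (hA₀.mul_X_pow 1).add (HasParityTerm.sum (n := 2 * (g + 1) + 1)
      (Finset.range (g + 2)) (v := fun k => Φ k * X ^ (2 * k)) fun k hk => by
        have := (hΦ' k).mul_X_pow (2 * k)
        have hk := Finset.mem_range.1 hk
        rwa [show 2 * (g + 1 - k) + 1 + 2 * k = 2 * (g + 1) + 1 by omega] at this)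
    convert h₁ using 1
    have h₂ := oddLeadingCoeff_add_sum (Nat.succ_ne_zero g)
    rw [Finset.sum_range_succ] at h₂
    rw [Finset.sum_range_succ, if_neg (by omega), add_zero, Finset.sum_congr rfl
      (fun k hk => if_pos (Nat.lt_succ_iff.1 (Finset.mem_range.1 hk)))]
    linarith
  -- A multiple of `X` is odd and killed by `secondDiff`. At `x = p` these corrections cancel `T`
  -- monomial by monomial; for `k ≤ g` they lie below the leading degree.
  set Ψ' : ℕ → ℚ[X] := fun k => Φ k + (-T.coeff (2 * k + 1)) • X ^ 1 with hΨ'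
  have hΨ₀ : ∀ k ≤ g + 1,
      HasParityTerm (2 * (g + 1 - k) + 1) (evenLeadingCoeff (g + 1) k) (Ψ' k) := by
    intro k hk
    have hX := (HasParityTerm.X_pow 1).smul (-T.coeff (2 * k + 1))
    have hk' := hΦ' k
    obtain hk₁ | rfl : k ≤ g ∨ k = g + 1 := by omega
    · have h₁ := hX.raise (g + 1 - k) (by omega)
      rw [add_comm] at h₁
      rw [if_pos hk₁] at hk'
      convert hk'.add h₁ using 1
      rw [add_zero]
    · rw [if_neg (by omega)] at hk'
      have h₂ := hT₀.coeff_eq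
      rw [Nat.sub_self, mul_zero, zero_add] at hk' ⊢
      convert hk'.add hX using 1
      rw [h₂, neg_neg, mul_one, zero_add]
  have hΨ₂ : ∀ k, secondDiff (Ψ' k) = if k ≤ g then -Ψ k else 0 := by
    intro k
    rw [hΨ', map_add, hΦ, pow_one, map_smul, secondDiff_X, smul_zero, add_zero]
  refine ⟨A', Ψ', hA₀, hΨ₀, fun n c hc => ?_⟩
  set f : ℤ → ℚ := fun m => A'.eval (2 * m + 1 : ℚ) * (2 * n + 1) ^ (g + 1 + 1) +
    ∑ k ∈ Finset.range (g + 1 + 1), (Ψ' k).eval (2 * m + 1 : ℚ) * (2 * n + 1) ^ (g + 1 + 2 * k)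
    with hf
  rw [verlindeDim_succ rfl hc]
  push_cast
  have key := sum_green_mul (n := n) hc.le f (fun d => verlindeDim (2 * n + 1) (g + 1) d) ?_ ?_ ?_
  · rw [hf] at key
    push_cast at key
    exact key
  · have e₁ : ∀ k ∈ Finset.range (g + 1 + 1), (Ψ' k).eval (-1 : ℚ) = -(Ψ' k).eval 1 := by
      intro k hk
      rw [(hΨ₀ k (Nat.lt_succ_iff.1 (Finset.mem_range.1 hk))).eval_neg,
        (odd_two_mul_add_one _).neg_one_pow, neg_one_mul]
    simp only [hf]
    norm_num
    rw [hA₀.eval_neg, hA₁, ← Finset.sum_neg_distrib]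
    simp only [mul_zero, zero_mul, zero_add, neg_zero, add_zero]
    refine Finset.sum_congr rfl fun k hk => ?_
    rw [e₁ k hk, neg_mul]
  · have h₁ := hT₀.eval_eq_sum_odd (2 * n + 1)
    have h₂ : T.eval (2 * n + 1 : ℚ) = A'.eval (2 * n + 1 : ℚ) * (2 * n + 1) +
        ∑ k ∈ Finset.range (g + 2), (Φ k).eval (2 * n + 1 : ℚ) * (2 * n + 1) ^ (2 * k) := by
      simp [hT, eval_finsetSum]
    have h₃ : f n = (2 * n + 1) ^ (g + 1) * (T.eval (2 * n + 1 : ℚ) -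
        ∑ j ∈ Finset.range (g + 1 + 1), T.coeff (2 * j + 1) * (2 * n + 1 : ℚ) ^ (2 * j + 1)) := by
      rw [h₂, add_sub_assoc, ← Finset.sum_sub_distrib, mul_add, Finset.mul_sum]
      simp only [hf, hΨ', Int.cast_natCast]
      congr 1
      · ring
      · refine Finset.sum_congr rfl fun k _ => ?_
        simp only [eval_add, eval_smul, eval_pow, eval_X, smul_eq_mul]
        ring
    rw [h₃, h₁, sub_self, mul_zero]
  · intro d hd
    rw [h.verlindeDim_eq n d hd]
    have h₁ : A'.eval (2 * d + 1 + 2 : ℚ) - 2 * A'.eval (2 * d + 1 : ℚ) +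
        A'.eval (2 * d + 1 - 2 : ℚ) = -A.eval (2 * d + 1 : ℚ) := by
      rw [← eval_secondDiff, hA₂, eval_neg]
    have h₂ : ∀ k, (Ψ' k).eval (2 * d + 1 + 2 : ℚ) - 2 * (Ψ' k).eval (2 * d + 1 : ℚ) +
        (Ψ' k).eval (2 * d + 1 - 2 : ℚ) =
        if k ≤ g then -(Ψ k).eval (2 * d + 1 : ℚ) else 0 := by
      intro k
      rw [← eval_secondDiff, hΨ₂]
      split_ifs <;> simp
    have h₃ : ∑ k ∈ Finset.range (g + 1 + 1), ((Ψ' k).eval (2 * d + 1 + 2 : ℚ) -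
        2 * (Ψ' k).eval (2 * d + 1 : ℚ) + (Ψ' k).eval (2 * d + 1 - 2 : ℚ)) *
          (2 * n + 1 : ℚ) ^ (g + 1 + 2 * k) = -(2 * n + 1) *
        ∑ k ∈ Finset.range (g + 1), (Ψ k).eval (2 * d + 1 : ℚ) * (2 * n + 1) ^ (g + 2 * k) := by
      rw [Finset.sum_range_succ, h₂, if_neg (by omega), zero_mul, add_zero, Finset.mul_sum]
      refine Finset.sum_congr rfl fun k hk => ?_
      rw [h₂, if_pos (Nat.lt_succ_iff.1 (Finset.mem_range.1 hk))]
      ring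
    have e₁ : (2 * ((d + 1 : ℤ) : ℚ) + 1) = 2 * d + 1 + 2 := by push_cast; ring
    have e₂ : (2 * ((d - 1 : ℤ) : ℚ) + 1) = 2 * d + 1 - 2 := by push_cast; ring
    simp only [hf, e₁, e₂, Int.cast_natCast]
    simp only [add_mul, sub_mul, Finset.sum_add_distrib, Finset.sum_sub_distrib, mul_assoc,
      ← Finset.mul_sum] at h₃ ⊢
    linear_combination (2 * n + 1 : ℚ) ^ (g + 1 + 1) * h₁ + h₃

theorem exists_verlindeExpansion (g : ℕ) : ∃ A Ψ, VerlindeExpansion g A Ψ := by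
  induction g with
  | zero => exact ⟨_, _, verlindeExpansion_zero⟩
  | succ g ih =>
    obtain ⟨A, Ψ, h⟩ := ih
    exact h.succ

/-! ### Return to the variable c -/

/-- The factor `2 ^ n` cancels the powers of two in the denominators of `evenLeadingCoeff` and
`oddLeadingCoeff`. -/
theorem HasParityTerm.comp_two_mul_add_one {n : ℕ} {a : ℚ} {f : ℚ[X]} (hf : HasParityTerm n a f)
    (ha : a ≠ 0) : (f.comp (C 2 * X + C 1)).degree = n ∧
      (f.comp (C 2 * X + C 1)).leadingCoeff = a * 2 ^ n := by
  have hn : f.natDegree = n := natDegree_eq_of_le_of_coeff_ne_zero hf.1 (hf.2 ▸ ha)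
  have h₁ : (C (2 : ℚ) * X + C 1).natDegree = 1 := natDegree_linear two_ne_zero
  have h₂ : (f.comp (C 2 * X + C 1)).leadingCoeff = a * 2 ^ n := by
    rw [leadingCoeff_comp (by rw [h₁]; exact one_ne_zero), leadingCoeff_linear two_ne_zero,
      hn, leadingCoeff, hn, hf.2]
  refine ⟨?_, h₂⟩
  have h₃ : f.comp (C 2 * X + C 1) ≠ 0 := by
    rw [← leadingCoeff_ne_zero, h₂]
    exact mul_ne_zero ha (pow_ne_zero _ two_ne_zero)
  rw [degree_eq_natDegree h₃, natDegree_comp, h₁, hn, mul_one]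

theorem sum_verlindeExponents (g : ℕ) (F : ℕ → ℚ) :
    ∑ j ∈ verlindeExponents (g + 1), F j =
      F (g + 1) + ∑ k ∈ Finset.range (g + 1), F (g + 2 * k) := by
  rw [verlindeExponents, Finset.sum_union, Finset.sum_image, Finset.sum_singleton, add_comm]
  · rfl
  · intro i _ j _ h
    simp only at h
    omega
  · rw [Finset.disjoint_singleton_right, Finset.mem_image]
    rintro ⟨i, -, hi⟩
    omega

theorem mem_verlindeExponents {g j : ℕ} :
    j ∈ verlindeExponents (g + 1) ↔ j = g + 1 ∨ ∃ k ≤ g, j = g + 2 * k := by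
  simp only [verlindeExponents, Finset.mem_union, Finset.mem_image, Finset.mem_range,
    Finset.mem_singleton, Nat.add_sub_cancel, Nat.lt_succ_iff]
  constructor
  · rintro (⟨k, hk, rfl⟩ | h)
    · exact Or.inr ⟨k, hk, rfl⟩
    · exact Or.inl h
  · rintro (h | ⟨k, hk, rfl⟩)
    · exact Or.inr h
    · exact Or.inl ⟨k, hk, rfl⟩

end

theorem mainTheorem7 (g : ℕ) (hg : 1 ≤ g) :
    ∃ P : ℕ → Polynomial ℚ,
      (∀ p c : ℕ, Odd p → 2 * c + 3 ≤ p →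
        (verlindeDim p g c : ℚ) =
          ∑ j ∈ verlindeExponents g, (P j).eval (c : ℚ) * (p : ℚ) ^ j) ∧
      ∀ j ∈ verlindeExponents g,
        (P j).degree = ((3 * g - 2 - j : ℕ) : WithBot ℕ) ∧
        bernoulli (j + 1 - g) ≠ 0 ∧
        (P j).leadingCoeff =
          (-1) ^ g / (((j + 1 - g)! : ℚ) * ((3 * g - 2 - j)! : ℚ)) * bernoulli (j + 1 - g) := by
  obtain ⟨g, rfl⟩ := Nat.exists_eq_add_of_le' hg
  obtain ⟨A, Ψ, h⟩ := exists_verlindeExpansion g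
  set L : Polynomial ℚ := Polynomial.C 2 * Polynomial.X + Polynomial.C 1 with hL
  -- The exponents `g + 2k` have the parity of `g`, so `g + 1` is never one of them and the cases do
  -- not collide.
  set P : ℕ → Polynomial ℚ := fun j => if j = g + 1 then A.comp L else (Ψ ((j - g) / 2)).comp L
  have hP₁ : P (g + 1) = A.comp L := if_pos rfl
  have hP₂ : ∀ k, P (g + 2 * k) = (Ψ k).comp L := fun k => by
    simp only [P]
    rw [if_neg (by omega), Nat.add_sub_cancel_left, Nat.mul_div_cancel_left _ two_pos]
  refine ⟨P, fun p c hp hc => ?_, fun j hj => ?_⟩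
  · obtain ⟨n, rfl⟩ := hp
    rw [h.verlindeDim_eq n c (by omega), sum_verlindeExponents, hP₁]
    have hev : L.eval (c : ℚ) = 2 * c + 1 := by simp [hL]
    simp only [hP₂, Polynomial.eval_comp, hev]
    push_cast
    rfl
  · obtain rfl | ⟨k, hk, rfl⟩ := mem_verlindeExponents.1 hj
    · have hne : oddLeadingCoeff g ≠ 0 := by
        unfold oddLeadingCoeff
        exact div_ne_zero (pow_ne_zero _ (by norm_num)) (by positivity)
      obtain ⟨h₁, h₂⟩ := h.odd_coeff.comp_two_mul_add_one hne
      rw [hP₁, h₁, h₂, show 3 * (g + 1) - 2 - (g + 1) = 2 * g by omega,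
        show g + 1 + 1 - (g + 1) = 1 by omega, bernoulli_one, oddLeadingCoeff]
      refine ⟨rfl, by norm_num, ?_⟩
      rw [Nat.factorial_one]
      field_simp
      push_cast
      ring
    · have hB := bernoulli_two_mul_ne_zero k
      have hne : evenLeadingCoeff g k ≠ 0 := by
        unfold evenLeadingCoeff
        exact div_ne_zero (mul_ne_zero (pow_ne_zero _ (by norm_num)) hB) (by positivity)
      obtain ⟨h₁, h₂⟩ := (h.even_coeff k hk).comp_two_mul_add_one hne
      rw [hP₂, h₁, h₂, show 3 * (g + 1) - 2 - (g + 2 * k) = 2 * (g - k) + 1 by omega,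
        show g + 2 * k + 1 - (g + 1) = 2 * k by omega, evenLeadingCoeff]
      refine ⟨rfl, hB, ?_⟩
      field_simp
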